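/- Let $(M,g)$ be a smooth ($C^\infty$) Riemannian manifold (without boundary, not necessarily compact) with Levi-Civita connection $\nabla$, and let $V$ be a finite-dimensional real inner product space. Write $D$ for the natural flat connection (componentwise differentiation) of the trivial bundle $M\times V$, and use the curvature convention $$R(X,Y)Z=\nabla_Y\nabla_XZ-\nabla_X\nabla_YZ+\nabla_{[X,Y]}Z .$$ A smooth $V$-valued one-form $\Omega$ on $M$ is called a virtual immersion if, for every $p\in M$ and all $X,Y,Z\in T_pM$, $$\langle\Omega_p(X),\Omega_p(Y)\rangle=g_p(X,Y)\quad\text{and}\quad\langle (d\Omega)_p(X,Y),\Omega_p(Z)\rangle=0 .$$ In this case $TM$ is identified with its image under $\Omega$ in $M\times V$, and $\perp$ denotes the orthogonal projection onto the normal bundle $(TM)^\perp\subset M\times V$. The second fundamental form is $I\!I(X,Y)=(D_X\Omega(Y))^\perp$, and $$(D_XI\!I)(Y,Z)=D_X\big(I\!I(Y,Z)\big)-I\!I(\nabla_XY,Z)-I\!I(Y,\nabla_XZ)\in V .$$ Suppose that $\Omega$ is a $V$-valued virtual immersion of $(M,g)$ whose second fundamental form is skew-symmetric, $I\!I(X,Y)=-I\!I(Y,X)$.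 Then, for all smooth vector fields $X,Y,Z,W$ on $M$: (a) $\langle R(X,Y)Z,W\rangle=\langle I\!I(X,Y),I\!I(Z,W)\rangle$; (b) $(D_XI\!I)(Y,Z)=-\Omega\big(R(Y,Z)X\big)$, that is, $(D_XI\!I)(Y,Z)=-R(Y,Z)X$ under the identification above; (c) $\nabla R=0$, that is, $(M,g)$ is locally symmetric. -/

import Mathlib

open Bundle Set
open scoped Manifold ContDiff Topology RealInnerProductSpace

noncomputable section
namespace VirtualImmersions

/-! ### The Levi-Civita connection, built from the Koszul formula -/

variable {E : Type*} [NormedAddCommGroup E] [NormedSpace ℝ E]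
  {H : Type*} [TopologicalSpace H] (I : ModelWithCorners ℝ E H)
  {M : Type*} [TopologicalSpace M] [ChartedSpace H M]

/-- The right-hand side of the Koszul formula
`2⟨∇_X Y, Z⟩ = X⟨Y, Z⟩ + Y⟨Z, X⟩ - Z⟨X, Y⟩ + ⟨[X, Y], Z⟩ - ⟨[Y, Z], X⟩ - ⟨[X, Z], Y⟩`. -/
def koszul [RiemannianBundle (fun x : M ↦ TangentSpace I x)]
    (X Y Z : Π x : M, TangentSpace I x) (x : M) : ℝ :=
  mvfderiv I (fun y ↦ ⟪Y y, Z y⟫) x (X x) + mvfderiv I (fun y ↦ ⟪Z y, X y⟫) x (Y x)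
    - mvfderiv I (fun y ↦ ⟪X y, Y y⟫) x (Z x)
    + ⟪VectorField.mlieBracket I X Y x, Z x⟫ - ⟪VectorField.mlieBracket I Y Z x, X x⟫
    - ⟪VectorField.mlieBracket I X Z x, Y x⟫

variable [RiemannianBundle (fun x : M ↦ TangentSpace I x)] [IsManifold I ∞ M]
  [IsContMDiffRiemannianBundle I ∞ E (fun x : M ↦ TangentSpace I x)]

variable {I}

theorem mdifferentiableAt_inner {x : M} {X Y : Π x : M, TangentSpace I x}
    (hX : MDiffAt (T% X) x) (hY : MDiffAt (T% Y) x) :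
    MDifferentiableAt I 𝓘(ℝ, ℝ) (fun y ↦ ⟪X y, Y y⟫) x :=
  MDifferentiableAt.inner_bundle (F := E) (E := fun x : M ↦ TangentSpace I x) hX hY

variable [FiniteDimensional ℝ E]

theorem koszul_tensorial_left {x : M} {Y Z : Π x : M, TangentSpace I x}
    (hY : MDiffAt (T% Y) x) (hZ : MDiffAt (T% Z) x) :
    TensorialAt I E (fun X ↦ koszul I X Y Z x) x where
  smul {f X} hf hX := by
    have h1 := mdifferentiableAt_inner hZ hX
    have h2 := mdifferentiableAt_inner hX hY
    simp only [koszul]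
    have e1 : (fun y ↦ ⟪Z y, (f • X) y⟫) = fun y ↦ f y * ⟪Z y, X y⟫ := by
      ext y; simp [inner_smul_right]
    have e2 : (fun y ↦ ⟪(f • X) y, Y y⟫) = fun y ↦ f y * ⟪X y, Y y⟫ := by
      ext y; simp [inner_smul_left]
    rw [e1, e2, mvfderiv_fun_mul hf h1, mvfderiv_fun_mul hf h2,
      VectorField.mlieBracket_smul_left hf hX, VectorField.mlieBracket_smul_left hf hX]
    simp [inner_add_left, inner_smul_left, inner_smul_right]
    rw [real_inner_comm (X x) (Z x)]
    ring
  add {X X'} hX hX' := by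
    have e1 : (fun y ↦ ⟪Z y, (X + X') y⟫) = fun y ↦ ⟪Z y, X y⟫ + ⟪Z y, X' y⟫ := by
      ext y; simp [inner_add_right]
    have e2 : (fun y ↦ ⟪(X + X') y, Y y⟫) = fun y ↦ ⟪X y, Y y⟫ + ⟪X' y, Y y⟫ := by
      ext y; simp [inner_add_left]
    simp only [koszul]
    rw [e1, e2, mvfderiv_fun_add (mdifferentiableAt_inner hZ hX) (mdifferentiableAt_inner hZ hX'),
      mvfderiv_fun_add (mdifferentiableAt_inner hX hY) (mdifferentiableAt_inner hX' hY),
      VectorField.mlieBracket_add_left hX hX', VectorField.mlieBracket_add_left hX hX']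
    simp [inner_add_left, inner_add_right]
    ring

theorem koszul_tensorial_right {x : M} {X Y : Π x : M, TangentSpace I x}
    (hX : MDiffAt (T% X) x) (hY : MDiffAt (T% Y) x) :
    TensorialAt I E (fun Z ↦ koszul I X Y Z x) x where
  smul {f Z} hf hZ := by
    simp only [koszul]
    have e1 : (fun y ↦ ⟪(f • Z) y, X y⟫) = fun y ↦ f y * ⟪Z y, X y⟫ := by
      ext y; simp [inner_smul_left]
    have e2 : (fun y ↦ ⟪Y y, (f • Z) y⟫) = fun y ↦ f y * ⟪Y y, Z y⟫ := by
      ext y; simp [inner_smul_right]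
    rw [e1, e2, mvfderiv_fun_mul hf (mdifferentiableAt_inner hZ hX),
      mvfderiv_fun_mul hf (mdifferentiableAt_inner hY hZ),
      VectorField.mlieBracket_smul_right hf hZ, VectorField.mlieBracket_smul_right hf hZ]
    simp [inner_add_left, inner_smul_left, inner_smul_right]
    rw [real_inner_comm (Y x) (Z x)]
    ring
  add {Z Z'} hZ hZ' := by
    have e1 : (fun y ↦ ⟪(Z + Z') y, X y⟫) = fun y ↦ ⟪Z y, X y⟫ + ⟪Z' y, X y⟫ := by
      ext y; simp [inner_add_left]
    have e2 : (fun y ↦ ⟪Y y, (Z + Z') y⟫) = fun y ↦ ⟪Y y, Z y⟫ + ⟪Y y, Z' y⟫ := by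
      ext y; simp [inner_add_right]
    simp only [koszul]
    rw [e1, e2, mvfderiv_fun_add (mdifferentiableAt_inner hZ hX) (mdifferentiableAt_inner hZ' hX),
      mvfderiv_fun_add (mdifferentiableAt_inner hY hZ) (mdifferentiableAt_inner hY hZ'),
      VectorField.mlieBracket_add_right hZ hZ', VectorField.mlieBracket_add_right hZ hZ']
    simp [inner_add_left, inner_add_right]
    ring

open Classical in
/-- The linear map `v ↦ ∇_v Y` on the tangent space at `x`, obtained from the Koszul expression by
Riesz duality (and set to `0` if `Y` is not differentiable at `x`). -/
def leviCivitaAux (Y : Π x : M, TangentSpace I x) (x : M) :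
    TangentSpace I x →L[ℝ] TangentSpace I x :=
  have : FiniteDimensional ℝ (TangentSpace I x) := inferInstanceAs (FiniteDimensional ℝ E)
  have : CompleteSpace (TangentSpace I x) := FiniteDimensional.complete ℝ _
  if hY : MDiffAt (T% Y) x then
    (1 / 2 : ℝ) • InnerProductSpace.continuousLinearMapOfBilin (𝕜 := ℝ)
      (TensorialAt.mkHom₂ (I := I) (F := E) (F' := E) (fun X Z ↦ koszul I X Y Z x) x
        (fun _ hZ ↦ koszul_tensorial_left hY hZ) (fun _ hX ↦ koszul_tensorial_right hX hY))
  else 0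

theorem two_inner_leviCivitaAux {x : M} {X Y Z : Π x : M, TangentSpace I x}
    (hX : MDiffAt (T% X) x) (hY : MDiffAt (T% Y) x) (hZ : MDiffAt (T% Z) x) :
    2 * ⟪leviCivitaAux Y x (X x), Z x⟫ = koszul I X Y Z x := by
  have : FiniteDimensional ℝ (TangentSpace I x) := inferInstanceAs (FiniteDimensional ℝ E)
  have : CompleteSpace (TangentSpace I x) := FiniteDimensional.complete ℝ _
  rw [leviCivitaAux, dif_pos hY, _root_.smul_apply, inner_smul_left,
    InnerProductSpace.continuousLinearMapOfBilin_apply]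
  simp only [conj_trivial, one_div]
  rw [← mul_assoc, mul_inv_cancel₀ two_ne_zero, one_mul]
  exact TensorialAt.mkHom₂_apply _ _ hX hZ


theorem koszul_add_middle {x : M} {X Y Y' Z : Π x : M, TangentSpace I x}
    (hX : MDiffAt (T% X) x) (hY : MDiffAt (T% Y) x) (hY' : MDiffAt (T% Y') x)
    (hZ : MDiffAt (T% Z) x) :
    koszul I X (Y + Y') Z x = koszul I X Y Z x + koszul I X Y' Z x := by
  have e1 : (fun y ↦ ⟪(Y + Y') y, Z y⟫) = fun y ↦ ⟪Y y, Z y⟫ + ⟪Y' y, Z y⟫ := by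
    ext y; simp [inner_add_left]
  have e2 : (fun y ↦ ⟪X y, (Y + Y') y⟫) = fun y ↦ ⟪X y, Y y⟫ + ⟪X y, Y' y⟫ := by
    ext y; simp [inner_add_right]
  simp only [koszul]
  rw [e1, e2, mvfderiv_fun_add (mdifferentiableAt_inner hY hZ) (mdifferentiableAt_inner hY' hZ),
    mvfderiv_fun_add (mdifferentiableAt_inner hX hY) (mdifferentiableAt_inner hX hY'),
    VectorField.mlieBracket_add_right hY hY', VectorField.mlieBracket_add_left hY hY']
  simp [inner_add_left, inner_add_right]
  ring

theorem koszul_smul_middle {x : M} {f : M → ℝ} {X Y Z : Π x : M, TangentSpace I x}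
    (hf : MDiffAt f x) (hX : MDiffAt (T% X) x) (hY : MDiffAt (T% Y) x)
    (hZ : MDiffAt (T% Z) x) :
    koszul I X (f • Y) Z x = f x * koszul I X Y Z x + 2 * (mvfderiv I f x (X x) * ⟪Y x, Z x⟫) := by
  have e1 : (fun y ↦ ⟪(f • Y) y, Z y⟫) = fun y ↦ f y * ⟪Y y, Z y⟫ := by
    ext y; simp [inner_smul_left]
  have e2 : (fun y ↦ ⟪X y, (f • Y) y⟫) = fun y ↦ f y * ⟪X y, Y y⟫ := by
    ext y; simp [inner_smul_right]
  simp only [koszul]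
  rw [e1, e2, mvfderiv_fun_mul hf (mdifferentiableAt_inner hY hZ),
    mvfderiv_fun_mul hf (mdifferentiableAt_inner hX hY),
    VectorField.mlieBracket_smul_right hf hY, VectorField.mlieBracket_smul_left hf hY]
  simp [inner_add_left, inner_smul_left, inner_smul_right]
  rw [real_inner_comm (X x) (Y x)]
  ring

variable (I M) in
/-- The Levi-Civita connection of a Riemannian manifold. -/
def leviCivita : CovariantDerivative I E (fun x : M ↦ TangentSpace I x) where
  toFun := leviCivitaAux
  isCovariantDerivativeOnUniv :=
    { add := by
        intro Y Y' x hY hY' _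
        ext1 v
        refine ext_inner_right ℝ fun w ↦ ?_
        have hX := FiberBundle.mdifferentiableAt_extend I E v
        have hZ := FiberBundle.mdifferentiableAt_extend I E w
        have h0 := two_inner_leviCivitaAux hX (mdifferentiableAt_add_section hY hY') hZ
        have h1 := two_inner_leviCivitaAux hX hY hZ
        have h2 := two_inner_leviCivitaAux hX hY' hZ
        rw [koszul_add_middle hX hY hY' hZ] at h0
        simp only [FiberBundle.extend_apply_self] at h0 h1 h2
        rw [_root_.add_apply, inner_add_left]
        linarith
      leibniz := by
        intro Y f x hY hf _
        ext1 v
        refine ext_inner_right ℝ fun w ↦ ?_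
        have hX := FiberBundle.mdifferentiableAt_extend I E v
        have hZ := FiberBundle.mdifferentiableAt_extend I E w
        have h0 := two_inner_leviCivitaAux hX (hf.smul_section hY) hZ
        have h1 := two_inner_leviCivitaAux hX hY hZ
        rw [koszul_smul_middle hf hX hY hZ] at h0
        simp only [FiberBundle.extend_apply_self] at h0 h1
        simp only [_root_.add_apply, _root_.smul_apply, ContinuousLinearMap.smulRight_apply,
          inner_add_left, inner_smul_left, conj_trivial]
        linear_combination h0 / 2 - f x * h1 / 2 }

/-- The Levi-Civita connection is torsion-free. -/
theorem leviCivita_torsion_eq_zero : (leviCivita I M).torsion = 0 := by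
  rw [CovariantDerivative.torsion_eq_zero_iff]
  intro X Y x hX hY
  refine ext_inner_right ℝ fun w ↦ ?_
  have hZ := FiberBundle.mdifferentiableAt_extend I E w
  have h1 := two_inner_leviCivitaAux hX hY hZ
  have h2 := two_inner_leviCivitaAux hY hX hZ
  have c : ∀ A B : Π x : M, TangentSpace I x,
      (fun y ↦ ⟪A y, B y⟫) = fun y ↦ ⟪B y, A y⟫ := fun A B ↦ by
    ext y; exact real_inner_comm _ _
  rw [koszul] at h1 h2
  rw [c (FiberBundle.extend E w) X] at h1
  rw [c (FiberBundle.extend E w) Y, c Y X,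
    VectorField.mlieBracket_swap_apply (V := Y) (W := X), inner_neg_left] at h2
  simp only [FiberBundle.extend_apply_self] at h1 h2
  change ⟪leviCivitaAux Y x (X x) - leviCivitaAux X x (Y x), w⟫ = _
  rw [inner_sub_left]
  linarith

/-- The Levi-Civita connection is compatible with the metric. -/
theorem leviCivita_inner {x : M} {X Y Z : Π x : M, TangentSpace I x}
    (hX : MDiffAt (T% X) x) (hY : MDiffAt (T% Y) x) (hZ : MDiffAt (T% Z) x) :
    mvfderiv I (fun y ↦ ⟪Y y, Z y⟫) x (X x) =
      ⟪leviCivita I M Y x (X x), Z x⟫ + ⟪Y x, leviCivita I M Z x (X x)⟫ := by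
  have h1 := two_inner_leviCivitaAux hX hY hZ
  have h2 := two_inner_leviCivitaAux hX hZ hY
  have c : ∀ A B : Π x : M, TangentSpace I x,
      (fun y ↦ ⟪A y, B y⟫) = fun y ↦ ⟪B y, A y⟫ := fun A B ↦ by
    ext y; exact real_inner_comm _ _
  change _ = ⟪leviCivitaAux Y x (X x), Z x⟫ + ⟪Y x, leviCivitaAux Z x (X x)⟫
  rw [real_inner_comm _ (Y x)]
  rw [koszul] at h1 h2
  rw [c Z X] at h1
  rw [c Z Y, c Y X, VectorField.mlieBracket_swap_apply (V := Z) (W := Y), inner_neg_left] at h2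
  linarith

/-! ### Vector fields and curvature -/

variable (I) in
/-- A (globally defined) vector field is smooth, as a section of the tangent bundle. -/
def IsSmoothField (X : Π x : M, TangentSpace I x) : Prop :=
  ContMDiff I I.tangent ∞ (fun x ↦ (⟨x, X x⟩ : TangentBundle I M))

variable (I) in
/-- `∇_X Y` for the Levi-Civita connection `∇`. -/
def nabla (X Y : Π x : M, TangentSpace I x) : Π x : M, TangentSpace I x :=
  fun x ↦ leviCivita I M Y x (X x)

variable (I) in
/-- The curvature tensor, with the sign convention
`R(X, Y)Z = ∇_Y ∇_X Z - ∇_X ∇_Y Z + ∇_{[X, Y]} Z`. -/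
def curvature (X Y Z : Π x : M, TangentSpace I x) : Π x : M, TangentSpace I x :=
  nabla I Y (nabla I X Z) - nabla I X (nabla I Y Z) + nabla I (VectorField.mlieBracket I X Y) Z

variable (I) in
/-- The covariant derivative of the curvature tensor:
`(∇_W R)(X, Y)Z = ∇_W (R(X, Y)Z) - R(∇_W X, Y)Z - R(X, ∇_W Y)Z - R(X, Y)∇_W Z`. -/
def nablaCurvature (W X Y Z : Π x : M, TangentSpace I x) : Π x : M, TangentSpace I x :=
  nabla I W (curvature I X Y Z) - curvature I (nabla I W X) Y Z - curvature I X (nabla I W Y) Z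
    - curvature I X Y (nabla I W Z)

variable (I M) in
/-- A Riemannian manifold is locally symmetric if its curvature tensor is parallel, `∇R = 0`. -/
def IsLocallySymmetric : Prop :=
  ∀ W X Y Z : Π x : M, TangentSpace I x, IsSmoothField I W → IsSmoothField I X →
    IsSmoothField I Y → IsSmoothField I Z → nablaCurvature I W X Y Z = 0

/-! ### Virtual immersions -/

variable {V : Type*} [NormedAddCommGroup V] [InnerProductSpace ℝ V]

variable (I) in
/-- The derivative `D_X s` of a `V`-valued function `s` along `X`, that is, the natural flat
connection `D` of the trivial bundle `M × V`. -/
def flatD (X : Π x : M, TangentSpace I x) (s : M → V) : M → V :=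
  fun x ↦ mvfderiv I s x (X x)

/-- The section `Ω(X)` of `M × V`, for a vector field `X` and a `V`-valued one-form `Ω`. -/
def applyForm (Ω : Π x : M, TangentSpace I x →L[ℝ] V) (X : Π x : M, TangentSpace I x) : M → V :=
  fun x ↦ Ω x (X x)

/-- The exterior derivative `dΩ(X, Y) = D_X(Ω(Y)) - D_Y(Ω(X)) - Ω([X, Y])` of a `V`-valued
one-form `Ω`. -/
def dForm (Ω : Π x : M, TangentSpace I x →L[ℝ] V) (X Y : Π x : M, TangentSpace I x) : M → V :=
  flatD I X (applyForm Ω Y) - flatD I Y (applyForm Ω X)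
    - applyForm Ω (VectorField.mlieBracket I X Y)

/-- A smooth `V`-valued one-form `Ω` on a Riemannian manifold is a virtual immersion if it is
isometric on every tangent space and the tangent part of `dΩ` vanishes. -/
structure IsVirtualImmersion (Ω : Π x : M, TangentSpace I x →L[ℝ] V) : Prop where
  smooth : ContMDiff I.tangent 𝓘(ℝ, V) ∞ (fun v : TangentBundle I M ↦ Ω v.proj v.snd)
  isometric : ∀ (p : M) (u v : TangentSpace I p), ⟪Ω p u, Ω p v⟫ = ⟪u, v⟫
  dForm_normal : ∀ X Y : Π x : M, TangentSpace I x, IsSmoothField I X → IsSmoothField I Y →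
    ∀ (p : M) (z : TangentSpace I p), ⟪dForm Ω X Y p, Ω p z⟫ = 0

variable [FiniteDimensional ℝ V]

/-- The normal part `w^⊥` of `w ∈ V` at `p`: the orthogonal projection of `w` onto the normal
space, the orthogonal complement in `V` of the tangent space `Ω_p(T_p M)`. -/
def normalPart (Ω : Π x : M, TangentSpace I x →L[ℝ] V) (p : M) (w : V) : V :=
  (LinearMap.range (Ω p).toLinearMap)ᗮ.starProjection w

/-- The second fundamental form `II(X, Y) = (D_X Y)^⊥`, where the vector field `Y` is identified
with the section `Ω(Y)` of `M × V`. -/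
def secondFF (Ω : Π x : M, TangentSpace I x →L[ℝ] V) (X Y : Π x : M, TangentSpace I x) : M → V :=
  fun p ↦ normalPart Ω p (flatD I X (applyForm Ω Y) p)

/-- The second fundamental form is skew-symmetric. -/
def IsSkewSecondFF (Ω : Π x : M, TangentSpace I x →L[ℝ] V) : Prop :=
  ∀ X Y : Π x : M, TangentSpace I x, IsSmoothField I X → IsSmoothField I Y →
    secondFF Ω X Y = -secondFF Ω Y X

/-- The derivative `(D_X II)(Y, Z) = D_X(II(Y, Z)) - II(∇_X Y, Z) - II(Y, ∇_X Z)` of the second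
fundamental form, regarded as a `V`-valued tensor. -/
def derivSecondFF (Ω : Π x : M, TangentSpace I x →L[ℝ] V) (X Y Z : Π x : M, TangentSpace I x) :
    M → V :=
  flatD I X (secondFF Ω Y Z) - secondFF Ω (nabla I X Y) Z - secondFF Ω Y (nabla I X Z)

end VirtualImmersions

end

noncomputable section
namespace VirtualImmersions

variable {E : Type*} [NormedAddCommGroup E] [NormedSpace ℝ E]
  {H : Type*} [TopologicalSpace H] {I : ModelWithCorners ℝ E H}
  {M : Type*} [TopologicalSpace M] [ChartedSpace H M]
  {V : Type*} [NormedAddCommGroup V]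

/-! ### The flat connection -/

section Flat

/-! Pulled back through Ω, the tangent part of the flat connection D is metric, because Ω is
isometric, and torsion-free, because the tangent part of dΩ vanishes. Hence it is ∇, and D splits as
∇ plus II. Flatness of D then becomes one V-valued identity (`applyForm_curvature`), Ω(R(X,Y)Z) =
(D_X II)(Y,Z) - (D_Y II)(X,Z), valid for every virtual immersion. Pairing it with tangent vectors
gives the Gauss equation.

Skew-symmetry enters through the first Bianchi identity. In the Gauss equation, the cyclic sum
relates the three products of values of II, and this relation is (a). For (b), put a = (D_X
II)(Y,Z), with b and c its cyclic permutations. Skew-symmetry turns the V-valued identity into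
ΩR(X,Y)Z = a + b, ΩR(Y,Z)X = b + c and ΩR(Z,X)Y = c + a. Bianchi gives a + b + c = 0, so a =
-ΩR(Y,Z)X.

By (b) the covariant derivative of II is tangent, hence orthogonal to II. Differentiating (a) by the
product rule therefore leaves only the terms in which ∇ acts on an argument, which is ∇R = 0. -/

theorem flatD_add [NormedSpace ℝ V] {X : Π x : M, TangentSpace I x} {s t : M → V} {p : M}
    (hs : MDifferentiableAt I 𝓘(ℝ, V) s p) (ht : MDifferentiableAt I 𝓘(ℝ, V) t p) :
    mvfderiv I (s + t) p (X p) = mvfderiv I s p (X p) + mvfderiv I t p (X p) := by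
  rw [mvfderiv_add hs ht, _root_.add_apply]

/-- The Leibniz rule for the inner product of two vector-valued functions. -/
theorem mvfderiv_inner [InnerProductSpace ℝ V] {s t : M → V} {p : M}
    (hs : MDifferentiableAt I 𝓘(ℝ, V) s p) (ht : MDifferentiableAt I 𝓘(ℝ, V) t p)
    (v : TangentSpace I p) :
    mvfderiv I (fun y ↦ ⟪s y, t y⟫) p v = ⟪mvfderiv I s p v, t p⟫ + ⟪s p, mvfderiv I t p v⟫ := by
  have hst : MDifferentiableAt I 𝓘(ℝ, ℝ) (fun y ↦ ⟪s y, t y⟫) p :=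
    ((isBoundedBilinearMap_inner (𝕜 := ℝ) (E := V)).differentiableAt
      (s p, t p)).mdifferentiableAt.comp p (hs.prodMk_space ht)
  have key := ((mdifferentiableAt_iff _ _).1 hs).2.hasFDerivWithinAt.inner ℝ
    ((mdifferentiableAt_iff _ _).1 ht).2.hasFDerivWithinAt
  rw [hs.mvfderiv, ht.mvfderiv, hst.mvfderiv]
  refine (DFunLike.congr_fun (key.fderivWithin I.uniqueDiffWithinAt_image) v).trans ?_
  refine (add_comm _ _).trans ?_
  simp [writtenInExtChartAt]
  rfl

/-- The derivative of a smooth function along a smooth vector field is smooth. -/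
theorem contMDiff_flatD [NormedSpace ℝ V] [IsManifold I ∞ M] {X : Π x : M, TangentSpace I x}
    {s : M → V}
    (hX : ContMDiff I I.tangent ∞ (fun x ↦ (⟨x, X x⟩ : TangentBundle I M)))
    (hs : ContMDiff I 𝓘(ℝ, V) ∞ s) :
    ContMDiff I 𝓘(ℝ, V) ∞ (fun x ↦ mvfderiv I s x (X x)) := by
  have h1 : ContMDiff I.tangent 𝓘(ℝ, V).tangent ∞ (tangentMap I 𝓘(ℝ, V) s) :=
    hs.contMDiff_tangentMap (by simp)
  exact contMDiff_snd_tangentBundle_modelSpace V 𝓘(ℝ, V) |>.comp (h1.comp hX)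

/-- The directional derivative of `s` at `q`, computed in the extended chart at `p`. -/
theorem mvfderiv_eq_fderivWithin_extChartAt [NormedSpace ℝ V] [IsManifold I ∞ M] {s : M → V}
    (hs : MDifferentiable I 𝓘(ℝ, V) s) (X : Π x : M, TangentSpace I x) {p : M} {y : E}
    (hy : y ∈ (extChartAt I p).target) :
    mvfderiv I s ((extChartAt I p).symm y) (X ((extChartAt I p).symm y)) =
      fderivWithin ℝ (s ∘ (extChartAt I p).symm) (range I) y
        (VectorField.mpullbackWithin 𝓘(ℝ, E) I (extChartAt I p).symm X (range I) y) := by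
  have hd : MDifferentiableWithinAt 𝓘(ℝ, E) I (extChartAt I p).symm (range I) y :=
    mdifferentiableWithinAt_extChartAt_symm hy
  have hu : UniqueMDiffWithinAt 𝓘(ℝ, E) (range I) y :=
    (I.uniqueDiffOn y (extChartAt_target_subset_range p hy)).uniqueMDiffWithinAt
  have h1 := mfderiv_comp_mfderivWithin y (hs _) hd hu
  rw [mfderivWithin_eq_fderivWithin] at h1
  rw [h1, VectorField.mpullbackWithin_apply]
  change mfderiv I 𝓘(ℝ, V) s _ _ = _
  change _ = mfderiv I 𝓘(ℝ, V) s _ (mfderivWithin 𝓘(ℝ, E) I (extChartAt I p).symm (range I) y _)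
  rw [(isInvertible_mfderivWithin_extChartAt_symm (I := I) hy).self_apply_inverse]

/-- The flat connection has no curvature: differentiation along `[X, Y]` is the commutator of
differentiation along `X` and `Y`. -/
theorem mvfderiv_mlieBracket [NormedSpace ℝ V] [CompleteSpace E] [IsManifold I ∞ M]
    {X Y : Π x : M, TangentSpace I x} {s : M → V}
    (hX : ContMDiff I I.tangent ∞ (fun x ↦ (⟨x, X x⟩ : TangentBundle I M)))
    (hY : ContMDiff I I.tangent ∞ (fun x ↦ (⟨x, Y x⟩ : TangentBundle I M)))
    (hs : ContMDiff I 𝓘(ℝ, V) ∞ s) (p : M) :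
    mvfderiv I s p (VectorField.mlieBracket I X Y p) =
      mvfderiv I (fun x ↦ mvfderiv I s x (Y x)) p (X p) -
        mvfderiv I (fun x ↦ mvfderiv I s x (X x)) p (Y p) := by
  have : IsManifold I 2 M := .of_le (n := ∞) (by norm_cast)
  have hmem : extChartAt I p p ∈ (extChartAt I p).target := mem_extChartAt_target p
  have hsd : MDifferentiable I 𝓘(ℝ, V) s := hs.mdifferentiable (by simp)
  set X' := VectorField.mpullbackWithin 𝓘(ℝ, E) I (extChartAt I p).symm X (range I)
  set Y' := VectorField.mpullbackWithin 𝓘(ℝ, E) I (extChartAt I p).symm Y (range I)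
  have hX' : DifferentiableWithinAt ℝ X' (range I) (extChartAt I p p) := by
    have := ((hX p).mdifferentiableAt (by simp)).mdifferentiableWithinAt (s := univ)
      |>.differentiableWithinAt_mpullbackWithin_vectorField
    rwa [preimage_univ, univ_inter] at this
  have hY' : DifferentiableWithinAt ℝ Y' (range I) (extChartAt I p p) := by
    have := ((hY p).mdifferentiableAt (by simp)).mdifferentiableWithinAt (s := univ)
      |>.differentiableWithinAt_mpullbackWithin_vectorField
    rwa [preimage_univ, univ_inter] at this
  -- Both iterated derivatives are read in the chart at p. The chart formula for the inner
  -- derivative holds on the chart target, a neighbourhood of the base point within `range I`, which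
  -- suffices to differentiate once more.
  have second : ∀ A B : Π x : M, TangentSpace I x,
      ContMDiff I I.tangent ∞ (fun x ↦ (⟨x, A x⟩ : TangentBundle I M)) →
      mvfderiv I (fun x ↦ mvfderiv I s x (A x)) p (B p) =
      fderivWithin ℝ (fun y ↦ fderivWithin ℝ (s ∘ (extChartAt I p).symm) (range I) y
        (VectorField.mpullbackWithin 𝓘(ℝ, E) I (extChartAt I p).symm A (range I) y)) (range I)
        (extChartAt I p p)
        (VectorField.mpullbackWithin 𝓘(ℝ, E) I (extChartAt I p).symm B (range I)
          (extChartAt I p p)) := by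
    intro A B hA
    have h := mvfderiv_eq_fderivWithin_extChartAt
      ((contMDiff_flatD hA hs).mdifferentiable (by simp)) B hmem
    rw [extChartAt_to_inv] at h
    rw [h]
    congr 1
    refine Filter.EventuallyEq.fderivWithin_eq_of_mem ?_ (mem_range_self _)
    filter_upwards [extChartAt_target_mem_nhdsWithin p] with y hy
    exact mvfderiv_eq_fderivWithin_extChartAt hsd A hy
  rw [second Y X hY, second X Y hX]
  have hs' : ContDiffWithinAt ℝ ∞ (s ∘ (extChartAt I p).symm) (range I) (extChartAt I p p) := by
    have := (contMDiffAt_iff.1 (hs p)).2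
    exact this
  -- The second derivatives of s cancel by symmetry, which holds within `range I` because this set
  -- lies in the closure of its interior.
  rw [← VectorField.fderivWithin_apply_lieBracket hs' (by simp; norm_cast) I.uniqueDiffOn
    (I.range_subset_closure_interior (mem_range_self _)) (mem_range_self _) hY' hX']
  have hL : VectorField.mlieBracket I X Y p =
      VectorField.lieBracketWithin ℝ X' Y' (range I) (extChartAt I p p) := by
    rw [← VectorField.mlieBracketWithin_univ, VectorField.mlieBracketWithin_apply,
      mfderiv_extChartAt_self]
    rw [preimage_univ, univ_inter]
    exact DFunLike.congr_fun (ContinuousLinearMap.inverse_id (R := ℝ) (M := TangentSpace I p)) _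
  rw [(hsd p).mvfderiv, hL]
  rfl

end Flat

/-! ### Smooth vector fields -/

section Fields

variable [IsManifold I ∞ M]

/-- Every tangent vector extends to a globally defined smooth vector field. -/
theorem exists_isSmoothField_apply_eq [FiniteDimensional ℝ E] [T2Space M]
    {p : M} (v : TangentSpace I p) :
    ∃ X : Π x : M, TangentSpace I x, IsSmoothField I X ∧ X p = v := by
  obtain ⟨s, hs, hsmooth⟩ := FiberBundle.exists_contMDiffOn_extend (k := ∞) I E v
  have hs' : interior s ∈ 𝓝 p := interior_mem_nhds.2 hs
  -- The local extension is smooth only near p; a bump function supported there makes it global.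
  obtain ⟨f, -, hf⟩ := (SmoothBumpFunction.nhds_basis_tsupport (I := I) p).mem_iff.1 hs'
  refine ⟨fun x ↦ f x • FiberBundle.extend E v x, ?_, by simp⟩
  exact ContMDiffOn.smul_section_of_tsupport f.contMDiff.contMDiffOn isOpen_interior hf
    (hsmooth.mono interior_subset)

variable {X Y Z : Π x : M, TangentSpace I x}

theorem IsSmoothField.mdifferentiableAt (hX : IsSmoothField I X) {p : M} : MDiffAt (T% X) p :=
  (ContMDiff.mdifferentiable hX (by simp)) p

theorem IsSmoothField.add (hX : IsSmoothField I X) (hY : IsSmoothField I Y) :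
    IsSmoothField I (X + Y) :=
  ContMDiff.add_section hX hY

theorem IsSmoothField.sub (hX : IsSmoothField I X) (hY : IsSmoothField I Y) :
    IsSmoothField I (X - Y) :=
  ContMDiff.sub_section hX hY

theorem IsSmoothField.mlieBracket [CompleteSpace E]
    (hX : IsSmoothField I X) (hY : IsSmoothField I Y) :
    IsSmoothField I (VectorField.mlieBracket I X Y) := by
  have : IsManifold I ((⊤ : ℕ∞) + 1) M := .of_le (n := ∞) (by norm_cast)
  have : IsManifold I (minSmoothness ℝ 2) M := .of_le (n := ∞) (by simp; norm_cast)
  intro p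
  exact ContMDiffAt.mlieBracket_vectorField (m := ⊤) (n := ⊤) (hX p) (hY p) (by simp)

variable [RiemannianBundle (fun x : M ↦ TangentSpace I x)]
  [IsContMDiffRiemannianBundle I ∞ E (fun x : M ↦ TangentSpace I x)]

theorem IsSmoothField.inner (hX : IsSmoothField I X) (hY : IsSmoothField I Y) :
    ContMDiff I 𝓘(ℝ, ℝ) ∞ (fun x ↦ ⟪X x, Y x⟫) :=
  ContMDiff.inner_bundle (E := fun x : M ↦ TangentSpace I x) hX hY

/-- A vector field is smooth if its inner products with all smooth vector fields are smooth. -/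
theorem isSmoothField_of_inner [FiniteDimensional ℝ E] [T2Space M]
    (h : ∀ Z : Π x : M, TangentSpace I x, IsSmoothField I Z →
      ContMDiff I 𝓘(ℝ, ℝ) ∞ (fun x ↦ ⟪X x, Z x⟫)) :
    IsSmoothField I X := by
  intro p
  have hfd : ∀ x : M, FiniteDimensional ℝ (TangentSpace I x) := fun _ ↦
    inferInstanceAs (FiniteDimensional ℝ E)
  let b := Module.finBasis ℝ (TangentSpace I p)
  choose Z hZ hZp using fun i ↦ exists_isSmoothField_apply_eq (b i)
  -- The fields `Z i` extend a basis at p. Where their Gram determinant is nonzero they form a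
  -- frame, and the coefficients of X solve a linear system with smooth data; Cramer's rule makes
  -- them smooth.
  let G : M → Matrix _ _ ℝ := fun x ↦ Matrix.gram ℝ (fun i ↦ Z i x)
  have hGs : ∀ i j, ContMDiff I 𝓘(ℝ, ℝ) ∞ (fun x ↦ G x i j) := fun i j ↦ (hZ i).inner (hZ j)
  have det_smooth : ∀ A : M → Matrix (Fin (Module.finrank ℝ (TangentSpace I p)))
      (Fin (Module.finrank ℝ (TangentSpace I p))) ℝ,
      (∀ i j, ContMDiff I 𝓘(ℝ, ℝ) ∞ (fun x ↦ A x i j)) →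
      ContMDiff I 𝓘(ℝ, ℝ) ∞ (fun x ↦ (A x).det) := by
    intro A hA
    simp only [Matrix.det_apply']
    exact contMDiff_finsetSum fun σ _ ↦ contMDiff_const.mul (contMDiff_finsetProd fun i _ ↦ hA _ _)
  have hGp : (G p).det ≠ 0 := by
    rw [Matrix.det_gram_ne_zero_iff_linearIndependent]
    simpa [hZp] using b.linearIndependent
  have hev : ∀ᶠ x in 𝓝 p, (G x).det ≠ 0 :=
    (det_smooth G hGs).continuous.continuousAt.eventually_ne hGp
  let c : Fin (Module.finrank ℝ (TangentSpace I p)) → M → ℝ := fun i x ↦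
    ((G x).cramer (fun j ↦ ⟪X x, Z j x⟫)) i / (G x).det
  have hc : ∀ i, ContMDiffAt I 𝓘(ℝ, ℝ) ∞ (c i) p := by
    intro i
    refine ContMDiffAt.div₀ ?_ (det_smooth G hGs p) hGp
    simp only [Matrix.cramer_apply]
    refine det_smooth _ (fun k l ↦ ?_) p
    simp only [Matrix.updateCol_apply]
    split_ifs
    exacts [h _ (hZ k), hGs k l]
  refine (ContMDiffAt.sum_section (t := fun i x ↦ c i x • Z i x) (s := Finset.univ)
    fun i _ ↦ (hc i).smul_section (hZ i p)).congr_of_eventuallyEq ?_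
  filter_upwards [hev] with x hx
  have hli : LinearIndependent ℝ (fun i ↦ Z i x) :=
    Matrix.det_gram_ne_zero_iff_linearIndependent.1 hx
  have hspan := hli.span_eq_top_of_card_eq_finrank' (by simp; rfl)
  obtain ⟨a, ha⟩ := Submodule.mem_span_range_iff_exists_fun ℝ |>.1
    (hspan ▸ Submodule.mem_top : X x ∈ Submodule.span ℝ (range fun i ↦ Z i x))
  have hv : (fun j ↦ ⟪X x, Z j x⟫) = (G x).mulVec a := by
    ext j
    rw [← ha, sum_inner]
    simp [G, Matrix.mulVec, dotProduct, Matrix.gram_apply, inner_smul_left, real_inner_comm,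
      mul_comm]
  have hca : ∀ i, c i x = a i := by
    intro i
    simp only [c]
    rw [hv, Matrix.cramer_eq_adjugate_mulVec, Matrix.mulVec_mulVec, Matrix.adjugate_mul,
      Matrix.smul_mulVec, Matrix.one_mulVec, Pi.smul_apply, smul_eq_mul, mul_div_cancel_left₀ _ hx]
  simp [hca, ha]

/-! ### The Levi-Civita connection -/

variable [FiniteDimensional ℝ E] {W : Π x : M, TangentSpace I x}

theorem two_inner_nabla (hX : IsSmoothField I X) (hY : IsSmoothField I Y) (hZ : IsSmoothField I Z)
    (p : M) : 2 * ⟪nabla I X Y p, Z p⟫ = koszul I X Y Z p :=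
  two_inner_leviCivitaAux hX.mdifferentiableAt hY.mdifferentiableAt hZ.mdifferentiableAt

/-- ∇ is defined pointwise by duality, so its smoothness is tested on inner products, where the
Koszul formula exhibits a smooth function. -/
theorem IsSmoothField.nabla [T2Space M] (hX : IsSmoothField I X) (hY : IsSmoothField I Y) :
    IsSmoothField I (nabla I X Y) := by
  refine isSmoothField_of_inner fun Z hZ ↦ ?_
  have h : (fun x ↦ ⟪VirtualImmersions.nabla I X Y x, Z x⟫) =
      fun x ↦ (1 / 2 : ℝ) * koszul I X Y Z x := by
    ext x
    rw [← two_inner_nabla hX hY hZ]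
    ring
  rw [h]
  refine contMDiff_const.mul ?_
  have := FiniteDimensional.complete ℝ E
  exact (((((contMDiff_flatD hX (hY.inner hZ)).add (contMDiff_flatD hY (hZ.inner hX))).sub
    (contMDiff_flatD hZ (hX.inner hY))).add ((hX.mlieBracket hY).inner hZ)).sub
    ((hY.mlieBracket hZ).inner hX)).sub ((hX.mlieBracket hZ).inner hY)

theorem nabla_sub_nabla_swap (hX : IsSmoothField I X) (hY : IsSmoothField I Y) :
    nabla I X Y - nabla I Y X = VectorField.mlieBracket I X Y := by
  ext p
  exact (CovariantDerivative.torsion_eq_zero_iff (leviCivita I M)).1 leviCivita_torsion_eq_zero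
    hX.mdifferentiableAt hY.mdifferentiableAt

theorem nabla_add_right (hY : IsSmoothField I Y) (hZ : IsSmoothField I Z) :
    nabla I X (Y + Z) = nabla I X Y + nabla I X Z := by
  ext p
  have := (leviCivita I M).isCovariantDerivativeOnUniv.add (x := p)
    hY.mdifferentiableAt hZ.mdifferentiableAt
  simp [nabla, this]

theorem nabla_sub_right (hY : IsSmoothField I Y) (hZ : IsSmoothField I Z) :
    nabla I X (Y - Z) = nabla I X Y - nabla I X Z := by
  have := nabla_add_right (X := X) (hY.sub hZ) hZ
  rw [sub_add_cancel] at this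
  rw [this, add_sub_cancel_right]

/-- The first Bianchi identity. -/
theorem curvature_cyclic_sum [T2Space M]
    (hX : IsSmoothField I X) (hY : IsSmoothField I Y) (hZ : IsSmoothField I Z) :
    curvature I X Y Z + curvature I Y Z X + curvature I Z X Y = 0 := by
  have := FiniteDimensional.complete ℝ E
  have : IsManifold I (minSmoothness ℝ 3) M := .of_le (n := ∞) (by simp; norm_cast)
  have hle : minSmoothness ℝ 2 ≤ ∞ := by simp; norm_cast
  have jacobi := VectorField.leibniz_identity_mlieBracket (I := I) (ContMDiff.of_le hX hle)
    (ContMDiff.of_le hY hle) (ContMDiff.of_le hZ hle)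
  -- Torsion-freeness used twice: ∇_A(∇_B C - ∇_C B) = ∇_A[B,C] = ∇_{[B,C]}A + [A,[B,C]]. Over the
  -- cyclic sum the double brackets cancel by Jacobi.
  have d : ∀ {A B C : Π x : M, TangentSpace I x}, IsSmoothField I A → IsSmoothField I B →
      IsSmoothField I C → nabla I A (nabla I B C) - nabla I A (nabla I C B) =
        nabla I (VectorField.mlieBracket I B C) A +
          VectorField.mlieBracket I A (VectorField.mlieBracket I B C) := by
    intro A B C hA hB hC
    rw [← nabla_sub_right (hB.nabla hC) (hC.nabla hB), nabla_sub_nabla_swap hB hC,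
      ← nabla_sub_nabla_swap hA (hB.mlieBracket hC)]
    abel
  have neg : ∀ A B C : Π x : M, TangentSpace I x, nabla I (VectorField.mlieBracket I A B) C =
      -nabla I (VectorField.mlieBracket I B A) C := by
    intro A B C
    rw [VectorField.mlieBracket_swap]
    ext p
    simp [nabla]
  -- Antisymmetry inside an outer bracket: adding two instances of `d` with B and C exchanged
  -- cancels all ∇ terms.
  have b1 : VectorField.mlieBracket I X (VectorField.mlieBracket I Z Y) =
      -VectorField.mlieBracket I X (VectorField.mlieBracket I Y Z) := by
    linear_combination (norm := module) -neg Z Y X - d hX hZ hY - d hX hY hZ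
  have b2 : VectorField.mlieBracket I Z (VectorField.mlieBracket I Y X) =
      VectorField.mlieBracket I (VectorField.mlieBracket I X Y) Z := by
    rw [VectorField.mlieBracket_swap (V := VectorField.mlieBracket I X Y)]
    linear_combination (norm := module) -neg Y X Z - d hZ hY hX - d hZ hX hY
  simp only [curvature]
  linear_combination (norm := module) d hY hX hZ + d hX hZ hY + d hZ hY hX + neg X Z Y
    + neg Z Y X + neg Y X Z + b1 + b2 - jacobi

end Fields

/-! ### Virtual immersions -/

section Immersion

theorem inner_secondFF_apply [InnerProductSpace ℝ V] [FiniteDimensional ℝ V]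
    (Ω : Π x : M, TangentSpace I x →L[ℝ] V)
    (X Y : Π x : M, TangentSpace I x) (p : M) (z : TangentSpace I p) :
    ⟪secondFF Ω X Y p, Ω p z⟫ = 0 :=
  Submodule.inner_left_of_mem_orthogonal (LinearMap.mem_range_self (Ω p).toLinearMap z)
    (Submodule.starProjection_apply_mem _ _)

variable [RiemannianBundle (fun x : M ↦ TangentSpace I x)] [IsManifold I ∞ M]
  [InnerProductSpace ℝ V]
  {Ω : Π x : M, TangentSpace I x →L[ℝ] V} {U X Y Z W : Π x : M, TangentSpace I x}

namespace IsVirtualImmersion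

theorem contMDiff_applyForm (hΩ : IsVirtualImmersion Ω) (hX : IsSmoothField I X) :
    ContMDiff I 𝓘(ℝ, V) ∞ (applyForm Ω X) :=
  hΩ.smooth.comp hX

theorem inner_applyForm (hΩ : IsVirtualImmersion Ω) (X Y : Π x : M, TangentSpace I x) :
    (fun p ↦ ⟪applyForm Ω X p, applyForm Ω Y p⟫) = fun p ↦ ⟪X p, Y p⟫ := by
  ext p
  exact hΩ.isometric p _ _

variable [IsContMDiffRiemannianBundle I ∞ E (fun x : M ↦ TangentSpace I x)]
  [FiniteDimensional ℝ E]

/-- The tangent part of the flat derivative is the Levi-Civita connection. -/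
theorem inner_flatD_applyForm (hΩ : IsVirtualImmersion Ω) (hX : IsSmoothField I X)
    (hY : IsSmoothField I Y) (hZ : IsSmoothField I Z) (p : M) :
    ⟪flatD I X (applyForm Ω Y) p, applyForm Ω Z p⟫ = ⟪nabla I X Y p, Z p⟫ := by
  have leib : ∀ {A B C : Π x : M, TangentSpace I x}, IsSmoothField I B → IsSmoothField I C →
      mvfderiv I (fun y ↦ ⟪B y, C y⟫) p (A p) = ⟪flatD I A (applyForm Ω B) p, applyForm Ω C p⟫ +
        ⟪applyForm Ω B p, flatD I A (applyForm Ω C) p⟫ := by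
    intro A B C hB hC
    rw [← hΩ.inner_applyForm]
    exact mvfderiv_inner ((hΩ.contMDiff_applyForm hB).mdifferentiable (by simp) p)
      ((hΩ.contMDiff_applyForm hC).mdifferentiable (by simp) p) _
  have tors : ∀ {A B C : Π x : M, TangentSpace I x}, IsSmoothField I A → IsSmoothField I B →
      ⟪VectorField.mlieBracket I A B p, C p⟫ = ⟪flatD I A (applyForm Ω B) p, applyForm Ω C p⟫ -
        ⟪flatD I B (applyForm Ω A) p, applyForm Ω C p⟫ := by
    intro A B C hA hB
    have h := hΩ.dForm_normal A B hA hB p (C p)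
    rw [dForm, Pi.sub_apply, Pi.sub_apply, inner_sub_left, inner_sub_left] at h
    rw [← hΩ.isometric]
    change _ = ⟪_, Ω p (C p)⟫ - ⟪_, Ω p (C p)⟫
    simp only [applyForm] at h ⊢
    linarith
  -- Metric compatibility and vanishing torsion replace every term of the Koszul expression by
  -- products of D and Ω; all cancel except 2⟨D_X Ω(Y), Ω(Z)⟩.
  have key := two_inner_nabla hX hY hZ p
  rw [koszul, leib hY hZ, leib hZ hX, leib hX hY, tors hX hY, tors hY hZ, tors hX hZ] at key
  rw [real_inner_comm _ (applyForm Ω Y p), real_inner_comm _ (applyForm Ω Z p),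
    real_inner_comm _ (applyForm Ω X p)] at key
  linarith

variable [FiniteDimensional ℝ V] [T2Space M]

/-- The Gauss formula. -/
theorem secondFF_eq (hΩ : IsVirtualImmersion Ω) (hX : IsSmoothField I X) (hY : IsSmoothField I Y) :
    secondFF Ω X Y = flatD I X (applyForm Ω Y) - applyForm Ω (nabla I X Y) := by
  ext p
  have h : (LinearMap.range (Ω p).toLinearMap).starProjection (flatD I X (applyForm Ω Y) p) =
      applyForm Ω (nabla I X Y) p := by
    refine Submodule.eq_starProjection_of_mem_of_inner_eq_zero ⟨_, rfl⟩ ?_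
    rintro _ ⟨z, rfl⟩
    -- The projection is tested against single vectors, whereas the comparison with ∇ concerns
    -- fields.
    obtain ⟨Z, hZ, rfl⟩ := exists_isSmoothField_apply_eq z
    rw [inner_sub_left]
    have h1 := hΩ.inner_flatD_applyForm hX hY hZ p
    have h2 := hΩ.isometric p (nabla I X Y p) (Z p)
    exact sub_eq_zero.2 (h1.trans h2.symm)
  rw [secondFF, normalPart, Submodule.starProjection_orthogonal', _root_.sub_apply, h]
  rfl

/-- The Gauss formula writes II as a difference of smooth sections, so the smoothness of the
pointwise normal projection need not be studied. -/
theorem contMDiff_secondFF (hΩ : IsVirtualImmersion Ω)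
    (hX : IsSmoothField I X) (hY : IsSmoothField I Y) :
    ContMDiff I 𝓘(ℝ, V) ∞ (secondFF Ω X Y) := by
  rw [hΩ.secondFF_eq hX hY]
  exact (contMDiff_flatD hX (hΩ.contMDiff_applyForm hY)).sub (hΩ.contMDiff_applyForm (hX.nabla hY))

/-- Differentiate ⟨II(Y,Z), Ω(W)⟩ = 0 along X; of D_X Ω(W) only the normal part II(X,W) survives
against II(Y,Z). -/
theorem inner_flatD_secondFF (hΩ : IsVirtualImmersion Ω) (hX : IsSmoothField I X)
    (hY : IsSmoothField I Y) (hZ : IsSmoothField I Z) (hW : IsSmoothField I W) (p : M) :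
    ⟪flatD I X (secondFF Ω Y Z) p, Ω p (W p)⟫ = -⟪secondFF Ω Y Z p, secondFF Ω X W p⟫ := by
  have h0 : (fun p ↦ ⟪secondFF Ω Y Z p, applyForm Ω W p⟫) = fun _ ↦ (0 : ℝ) := by
    ext p
    exact inner_secondFF_apply Ω Y Z p (W p)
  have h1 := mvfderiv_inner ((hΩ.contMDiff_secondFF hY hZ).mdifferentiable (by simp) p)
    ((hΩ.contMDiff_applyForm hW).mdifferentiable (by simp) p) (X p)
  rw [h0, mvfderiv_const] at h1
  have h2 : mvfderiv I (applyForm Ω W) p (X p) =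
      Ω p (nabla I X W p) + secondFF Ω X W p := by
    rw [hΩ.secondFF_eq hX hW]
    simp [flatD, applyForm]
  rw [h2, inner_add_right, inner_secondFF_apply] at h1
  simp only [flatD, applyForm] at h1 ⊢
  simp at h1
  linarith

/-- The tangent part of the derivative of the second fundamental form. -/
theorem inner_derivSecondFF_apply (hΩ : IsVirtualImmersion Ω) (hX : IsSmoothField I X)
    (hY : IsSmoothField I Y) (hZ : IsSmoothField I Z) (hW : IsSmoothField I W) (p : M) :
    ⟪derivSecondFF Ω X Y Z p, Ω p (W p)⟫ = -⟪secondFF Ω Y Z p, secondFF Ω X W p⟫ := by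
  rw [derivSecondFF, Pi.sub_apply, Pi.sub_apply, inner_sub_left, inner_sub_left,
    inner_secondFF_apply, inner_secondFF_apply, hΩ.inner_flatD_secondFF hX hY hZ hW]
  ring

/-- The Gauss and Codazzi equations. -/
theorem applyForm_curvature (hΩ : IsVirtualImmersion Ω) (hX : IsSmoothField I X)
    (hY : IsSmoothField I Y) (hZ : IsSmoothField I Z) :
    applyForm Ω (curvature I X Y Z) = derivSecondFF Ω X Y Z - derivSecondFF Ω Y X Z := by
  have := FiniteDimensional.complete ℝ E
  have flat : flatD I (VectorField.mlieBracket I X Y) (applyForm Ω Z) =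
      flatD I X (flatD I Y (applyForm Ω Z)) - flatD I Y (flatD I X (applyForm Ω Z)) := by
    ext p
    exact mvfderiv_mlieBracket hX hY (hΩ.contMDiff_applyForm hZ) p
  have gauss : ∀ {A B : Π x : M, TangentSpace I x}, IsSmoothField I A → IsSmoothField I B →
      flatD I A (applyForm Ω B) = applyForm Ω (nabla I A B) + secondFF Ω A B := by
    intro A B hA hB
    rw [hΩ.secondFF_eq hA hB]
    abel
  have gauss₂ : ∀ {A B : Π x : M, TangentSpace I x}, IsSmoothField I A → IsSmoothField I B →
      flatD I A (flatD I B (applyForm Ω Z)) = applyForm Ω (nabla I A (nabla I B Z)) +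
        secondFF Ω A (nabla I B Z) + flatD I A (secondFF Ω B Z) := by
    intro A B hA hB
    rw [gauss hB hZ, ← gauss hA (hB.nabla hZ)]
    ext p
    exact flatD_add ((hΩ.contMDiff_applyForm (hB.nabla hZ)).mdifferentiable (by simp) p)
      ((hΩ.contMDiff_secondFF hB hZ).mdifferentiable (by simp) p)
  have split : secondFF Ω (VectorField.mlieBracket I X Y) Z =
      secondFF Ω (nabla I X Y) Z - secondFF Ω (nabla I Y X) Z := by
    rw [← nabla_sub_nabla_swap hX hY]
    ext p
    simp [secondFF, normalPart, flatD]
    abel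
  have hcurv : applyForm Ω (curvature I X Y Z) = applyForm Ω (nabla I Y (nabla I X Z)) -
      applyForm Ω (nabla I X (nabla I Y Z)) +
      applyForm Ω (nabla I (VectorField.mlieBracket I X Y) Z) := by
    ext p
    simp [applyForm, curvature]
  rw [gauss (hX.mlieBracket hY) hZ, gauss₂ hX hY, gauss₂ hY hX, split] at flat
  rw [hcurv]
  simp only [derivSecondFF]
  linear_combination (norm := module) flat

/-- The Gauss equation, obtained as the tangent part of `applyForm_curvature`; skew-symmetry of II
plays no role yet. -/
theorem inner_curvature (hΩ : IsVirtualImmersion Ω) (hX : IsSmoothField I X)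
    (hY : IsSmoothField I Y) (hZ : IsSmoothField I Z) (hW : IsSmoothField I W) (p : M) :
    ⟪curvature I X Y Z p, W p⟫ = ⟪secondFF Ω X Z p, secondFF Ω Y W p⟫ -
      ⟪secondFF Ω Y Z p, secondFF Ω X W p⟫ := by
  have h := congrFun (hΩ.applyForm_curvature hX hY hZ) p
  rw [← hΩ.isometric]
  change ⟪applyForm Ω (curvature I X Y Z) p, _⟫ = _
  rw [h, Pi.sub_apply, inner_sub_left, hΩ.inner_derivSecondFF_apply hX hY hZ hW,
    hΩ.inner_derivSecondFF_apply hY hX hZ hW]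
  ring

end IsVirtualImmersion

end Immersion

/-! ### Virtual immersions with skew-symmetric second fundamental form -/

section Skew

variable [RiemannianBundle (fun x : M ↦ TangentSpace I x)] [IsManifold I ∞ M]
  [IsContMDiffRiemannianBundle I ∞ E (fun x : M ↦ TangentSpace I x)] [FiniteDimensional ℝ E]
  [InnerProductSpace ℝ V] [FiniteDimensional ℝ V] [T2Space M]
  {Ω : Π x : M, TangentSpace I x →L[ℝ] V} {X Y Z W : Π x : M, TangentSpace I x}

theorem IsSmoothField.curvature (hX : IsSmoothField I X) (hY : IsSmoothField I Y)
    (hZ : IsSmoothField I Z) : IsSmoothField I (curvature I X Y Z) :=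
  have := FiniteDimensional.complete ℝ E
  ((hY.nabla (hX.nabla hZ)).sub (hX.nabla (hY.nabla hZ))).add ((hX.mlieBracket hY).nabla hZ)

namespace IsSkewSecondFF

/-- Insert the Gauss equation into the cyclic sum. Were II symmetric, everything would cancel; for
skew II the terms double instead, giving ⟨II(X,Z),II(Y,W)⟩ - ⟨II(Y,Z),II(X,W)⟩ = ⟨II(X,Y),II(Z,W)⟩,
whose left side is the curvature. -/
theorem inner_curvature_eq (hskew : IsSkewSecondFF Ω) (hΩ : IsVirtualImmersion Ω)
    (hX : IsSmoothField I X) (hY : IsSmoothField I Y) (hZ : IsSmoothField I Z)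
    (hW : IsSmoothField I W) (p : M) :
    ⟪curvature I X Y Z p, W p⟫ = ⟪secondFF Ω X Y p, secondFF Ω Z W p⟫ := by
  have bianchi := congrArg (⟪· , W p⟫) (congrFun (curvature_cyclic_sum hX hY hZ) p)
  simp only [Pi.add_apply, Pi.zero_apply, inner_add_left, inner_zero_left] at bianchi
  have h := hΩ.inner_curvature hX hY hZ hW p
  rw [h, hΩ.inner_curvature hY hZ hX hW p, hΩ.inner_curvature hZ hX hY hW p, hskew Y X hY hX,
    hskew Z X hZ hX, hskew Z Y hZ hY] at bianchi
  simp only [Pi.neg_apply, inner_neg_left] at bianchi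
  linarith

theorem derivSecondFF_swap (hskew : IsSkewSecondFF Ω) (hX : IsSmoothField I X)
    (hY : IsSmoothField I Y) (hZ : IsSmoothField I Z) :
    derivSecondFF Ω X Y Z = -derivSecondFF Ω X Z Y := by
  have h : flatD I X (secondFF Ω Y Z) = -flatD I X (secondFF Ω Z Y) := by
    rw [hskew Y Z hY hZ]
    ext p
    simp only [flatD, Pi.neg_apply]
    rw [mvfderiv_neg]
    rfl
  rw [derivSecondFF, derivSecondFF, h, hskew _ Z (hX.nabla hY) hZ, hskew Y _ hY (hX.nabla hZ)]
  abel

theorem derivSecondFF_eq (hskew : IsSkewSecondFF Ω) (hΩ : IsVirtualImmersion Ω)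
    (hX : IsSmoothField I X) (hY : IsSmoothField I Y) (hZ : IsSmoothField I Z) :
    derivSecondFF Ω X Y Z = -applyForm Ω (curvature I Y Z X) := by
  have bianchi : applyForm Ω (curvature I X Y Z) + applyForm Ω (curvature I Y Z X) +
      applyForm Ω (curvature I Z X Y) = 0 := by
    ext p
    have h := congrArg (Ω p) (congrFun (curvature_cyclic_sum hX hY hZ) p)
    simpa [applyForm] using h
  have h1 := hΩ.applyForm_curvature hX hY hZ
  have h2 := hΩ.applyForm_curvature hY hZ hX
  have h3 := hΩ.applyForm_curvature hZ hX hY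
  have s1 := hskew.derivSecondFF_swap hX hY hZ
  have s2 := hskew.derivSecondFF_swap hY hZ hX
  have s3 := hskew.derivSecondFF_swap hZ hX hY
  -- With a, b, c the cyclic values of the derivative of II, 2a = (a + b) + (c + a) - (b + c);
  -- Bianchi then evaluates the right side as -2ΩR(Y,Z)X.
  linear_combination (norm := module) (1 / 2 : ℝ) • (h2 - h1 - h3 + s1 + s2 - s3 + bianchi)

theorem nablaCurvature_eq_zero (hskew : IsSkewSecondFF Ω) (hΩ : IsVirtualImmersion Ω)
    (hW : IsSmoothField I W) (hX : IsSmoothField I X) (hY : IsSmoothField I Y)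
    (hZ : IsSmoothField I Z) : nablaCurvature I W X Y Z = 0 := by
  ext p
  refine ext_inner_right ℝ fun c ↦ ?_
  obtain ⟨C, hC, rfl⟩ := exists_isSmoothField_apply_eq c
  have hR : (fun y ↦ ⟪curvature I X Y Z y, C y⟫) =
      fun y ↦ ⟪secondFF Ω X Y y, secondFF Ω Z C y⟫ :=
    funext fun y ↦ hskew.inner_curvature_eq hΩ hX hY hZ hC y
  have h1 := leviCivita_inner (hW.mdifferentiableAt (p := p))
    (hX.curvature hY hZ).mdifferentiableAt hC.mdifferentiableAt
  have h2 := mvfderiv_inner ((hΩ.contMDiff_secondFF hX hY).mdifferentiable (by simp) p)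
    ((hΩ.contMDiff_secondFF hZ hC).mdifferentiable (by simp) p) (W p)
  -- Part (b) solved for D_W(II(A,B)); the curvature term is tangent and drops out when paired with
  -- II.
  have deriv : ∀ {A B : Π x : M, TangentSpace I x}, IsSmoothField I A → IsSmoothField I B →
      mvfderiv I (secondFF Ω A B) p (W p) = secondFF Ω (nabla I W A) B p +
        secondFF Ω A (nabla I W B) p - Ω p (curvature I A B W p) := by
    intro A B hA hB
    have h := congrFun (hskew.derivSecondFF_eq hΩ hW hA hB) p
    simp only [derivSecondFF, flatD, applyForm, Pi.sub_apply, Pi.neg_apply] at h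
    linear_combination (norm := module) h
  rw [hR, h2, deriv hX hY, deriv hZ hC] at h1
  simp only [inner_add_left, inner_sub_left, inner_add_right, inner_sub_right,
    real_inner_comm _ (Ω p _), inner_secondFF_apply] at h1
  change _ = ⟪nabla I W (curvature I X Y Z) p, C p⟫ + ⟪curvature I X Y Z p, nabla I W C p⟫ at h1
  -- Part (a) with ∇_W C in the last slot: this term cancels between the two expansions of the
  -- derivative of ⟨R(X,Y)Z, C⟩, and the other three are the corrections in ∇R.
  rw [hskew.inner_curvature_eq hΩ hX hY hZ (hW.nabla hC)] at h1
  simp only [nablaCurvature, Pi.sub_apply, Pi.zero_apply, inner_sub_left, inner_zero_left]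
  rw [hskew.inner_curvature_eq hΩ (hW.nabla hX) hY hZ hC,
    hskew.inner_curvature_eq hΩ hX (hW.nabla hY) hZ hC,
    hskew.inner_curvature_eq hΩ hX hY (hW.nabla hZ) hC]
  linarith

end IsSkewSecondFF

end Skew

end VirtualImmersions

end

theorem mainTheorem9 (n : ℕ)
    {M : Type*} [TopologicalSpace M] [T2Space M]
    [ChartedSpace (EuclideanSpace ℝ (Fin n)) M] [IsManifold (𝓡 n) ∞ M]
    [RiemannianBundle (fun x : M ↦ TangentSpace (𝓡 n) x)]
    [IsContMDiffRiemannianBundle (𝓡 n) ∞ (EuclideanSpace ℝ (Fin n))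
      (fun x : M ↦ TangentSpace (𝓡 n) x)]
    {V : Type*} [NormedAddCommGroup V] [InnerProductSpace ℝ V] [FiniteDimensional ℝ V]
    (Ω : Π x : M, TangentSpace (𝓡 n) x →L[ℝ] V)
    (hΩ : VirtualImmersions.IsVirtualImmersion Ω)
    (hskew : VirtualImmersions.IsSkewSecondFF Ω) :
    (∀ X Y Z W : Π x : M, TangentSpace (𝓡 n) x,
      VirtualImmersions.IsSmoothField (𝓡 n) X → VirtualImmersions.IsSmoothField (𝓡 n) Y →
      VirtualImmersions.IsSmoothField (𝓡 n) Z → VirtualImmersions.IsSmoothField (𝓡 n) W →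
      ∀ p : M, ⟪VirtualImmersions.curvature (𝓡 n) X Y Z p, W p⟫ =
        ⟪VirtualImmersions.secondFF Ω X Y p, VirtualImmersions.secondFF Ω Z W p⟫) ∧
    (∀ X Y Z : Π x : M, TangentSpace (𝓡 n) x,
      VirtualImmersions.IsSmoothField (𝓡 n) X → VirtualImmersions.IsSmoothField (𝓡 n) Y →
      VirtualImmersions.IsSmoothField (𝓡 n) Z →
      ∀ p : M, VirtualImmersions.derivSecondFF Ω X Y Z p =
        -(Ω p (VirtualImmersions.curvature (𝓡 n) Y Z X p))) ∧
    (∀ W X Y Z : Π x : M, TangentSpace (𝓡 n) x,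
      VirtualImmersions.IsSmoothField (𝓡 n) W → VirtualImmersions.IsSmoothField (𝓡 n) X →
      VirtualImmersions.IsSmoothField (𝓡 n) Y → VirtualImmersions.IsSmoothField (𝓡 n) Z →
      ∀ p : M, VirtualImmersions.nablaCurvature (𝓡 n) W X Y Z p = 0) ∧
    VirtualImmersions.IsLocallySymmetric (𝓡 n) M := by
  have hR {W X Y Z : Π x : M, TangentSpace (𝓡 n) x}
      (hW : VirtualImmersions.IsSmoothField (𝓡 n) W) (hX : VirtualImmersions.IsSmoothField (𝓡 n) X)
      (hY : VirtualImmersions.IsSmoothField (𝓡 n) Y)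
      (hZ : VirtualImmersions.IsSmoothField (𝓡 n) Z) :
      VirtualImmersions.nablaCurvature (𝓡 n) W X Y Z = 0 :=
    hskew.nablaCurvature_eq_zero hΩ hW hX hY hZ
  exact ⟨fun X Y Z W hX hY hZ hW p ↦ hskew.inner_curvature_eq hΩ hX hY hZ hW p,
    fun X Y Z hX hY hZ p ↦ congrFun (hskew.derivSecondFF_eq hΩ hX hY hZ) p,
    fun W X Y Z hW hX hY hZ p ↦ congrFun (hR hW hX hY hZ) p,
    fun W X Y Z hW hX hY hZ ↦ hR hW hX hY hZ⟩
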